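/- Let $1\le m<n$. An $m$-dimensional plane in $\mathbb{R}^n$ is an $m$-dimensional affine subspace. A set $E\subset\mathbb{R}^n$ is called $m$-convex with respect to a point $x\in\mathbb{R}^n\setminus E$ if there is an $m$-dimensional plane $L$ with $x\in L$ and $L\cap E=\varnothing$; it is called $m$-convex if it is $m$-convex with respect to every point $x\in\mathbb{R}^n\setminus E$. An open set $G\subset\mathbb{R}^n$ is called weakly $m$-convex if it is $m$-convex with respect to every point $x\in\partial G$. A closed set $E\subset\mathbb{R}^n$ is called weakly $m$-convex if there are open weakly $m$-convex sets $E_k$, $k=1,2,\ldots$, with $\overline{E_{k+1}}\subset E_k$ for all $k$ and $E=\bigcap_k E_k$. Theorem. For all integers $n\ge 3$ and $1\le m<n-1$ there exists a closed connected subset of $\mathbb{R}^n$ that is weakly $m$-convex but not $m$-convex, and there exists a domain (non-empty open connected set) in $\mathbb{R}^n$ that is weakly $m$-convex but not $m$-convex. -/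

import Mathlib

/-- `E` is `m`-convex with respect to the point `x`: some `m`-dimensional plane (affine subspace of
`ℝⁿ`) passes through `x` and misses `E`. (This forces `x ∉ E`.) -/
def IsMConvexAt {n : ℕ} (m : ℕ) (E : Set (EuclideanSpace ℝ (Fin n)))
    (x : EuclideanSpace ℝ (Fin n)) : Prop :=
  ∃ L : AffineSubspace ℝ (EuclideanSpace ℝ (Fin n)),
    Module.finrank ℝ L.direction = m ∧ x ∈ L ∧
      (L : Set (EuclideanSpace ℝ (Fin n))) ∩ E = ∅

/-- `E` is `m`-convex: it is `m`-convex with respect to every point of its complement. -/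
def IsMConvex {n : ℕ} (m : ℕ) (E : Set (EuclideanSpace ℝ (Fin n))) : Prop :=
  ∀ x, x ∉ E → IsMConvexAt m E x

/-- `G` is an open weakly `m`-convex set: it is open and `m`-convex with respect to each of its
boundary points. -/
def IsOpenWeaklyMConvex {n : ℕ} (m : ℕ) (G : Set (EuclideanSpace ℝ (Fin n))) : Prop :=
  IsOpen G ∧ ∀ x ∈ frontier G, IsMConvexAt m G x

/-- `A` is approximated from the outside by the sequence of open sets `U 0, U 1, …`. -/
def IsApproximatedFromOutside {n : ℕ} (A : Set (EuclideanSpace ℝ (Fin n)))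
    (U : ℕ → Set (EuclideanSpace ℝ (Fin n))) : Prop :=
  (∀ k, IsOpen (U k)) ∧ (∀ k, closure (U (k + 1)) ⊆ U k) ∧ A = ⋂ k, U k

/-- `E` is a closed weakly `m`-convex set: it is closed and can be approximated from the outside by
a family of open weakly `m`-convex sets. -/
def IsClosedWeaklyMConvex {n : ℕ} (m : ℕ) (E : Set (EuclideanSpace ℝ (Fin n))) : Prop :=
  IsClosed E ∧ ∃ U : ℕ → Set (EuclideanSpace ℝ (Fin n)),
    IsApproximatedFromOutside E U ∧ ∀ k, IsOpenWeaklyMConvex m (U k)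

/-- The class of `m`-convex sets in `ℝⁿ`. -/
def MConvexClass (n m : ℕ) : Set (Set (EuclideanSpace ℝ (Fin n))) :=
  {E | IsMConvex m E}

/-- The class of weakly `m`-convex sets in `ℝⁿ`, open or closed. -/
def WeaklyMConvexClass (n m : ℕ) : Set (Set (EuclideanSpace ℝ (Fin n))) :=
  {E | IsOpenWeaklyMConvex m E ∨ IsClosedWeaklyMConvex m E}

/-!
The construction starts from a cube and attaches to each of its facets `{x i = ±a}` a strip inside
the hyperplane of that facet, bounded in the direction of the single coordinate `x (i + 1)` (indices
cyclic) and unbounded in all others. Let `F` be the resulting closed set and let the domain be its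
complement.

* Each boundary point `x` of `F` lies on a strip, and the `(n - 2)`-plane on which the coordinates
  `i` and `i + 1` are those of `x` lies in that strip, hence misses `Fᶜ`
  (`isMConvexAt_compl_cyclicShell`). So `Fᶜ` is weakly `m`-convex for all `m ≤ n - 2`.
* A line through the centre of the cube leaves every bounded set, and each of its coordinates is
  either identically zero or eventually larger than `a`; it therefore leaves `F`
  (`not_isMConvexAt_compl_cyclicShell`). So `Fᶜ` is not `m`-convex at the centre for any `m ≥ 1`.
* Outside `F`, a coordinate `x i` may be moved freely as soon as `x (i + 1)` is large and
  `x (i - 1)` is not on a strip. Since the indices are cyclic, one large coordinate suffices to make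
  the others large one after another, so `Fᶜ` is path connected
  (`isConnected_compl_cyclicShell`).

None of this needs the strips to be thin. Replacing `{±a}` by the closed set `{b ≤ |t| ≤ a}`, and
letting `a` increase to `1` and `b` decrease to `0`, gives an increasing sequence of sets of the
same kind, each in the interior of the next one. The complements approximate the complement of
their union from outside, and this complement is the closed connected set.
-/

open Set Filter Topology

variable {n : ℕ}

/-! ### Subspaces on which two coordinates vanish -/

lemma exists_submodule_le_finrank_eq {V : Type*} [AddCommGroup V] [Module ℝ V]
    (W : Submodule ℝ V) [FiniteDimensional ℝ W] {m : ℕ} (hm : m ≤ Module.finrank ℝ W) :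
    ∃ U ≤ W, Module.finrank ℝ U = m := by
  obtain ⟨f, hf⟩ := exists_linearIndependent_of_le_finrank hm
  refine ⟨Submodule.span ℝ (range fun i => (f i : V)), ?_, ?_⟩
  · rw [Submodule.span_le]
    rintro _ ⟨i, rfl⟩
    exact (f i).2
  · have := finrank_span_eq_card (hf.map' W.subtype (Submodule.ker_subtype W))
    rwa [Fintype.card_fin] at this

/-- Two coordinates can be kept constant on an `m`-dimensional subspace as long as `m + 2 ≤ n`. -/
lemma exists_submodule_finrank_eq_of_two_coords {m : ℕ} (hm : m + 2 ≤ n) (i j : Fin n) :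
    ∃ U : Submodule ℝ (EuclideanSpace ℝ (Fin n)), Module.finrank ℝ U = m ∧
      ∀ v ∈ U, v i = 0 ∧ v j = 0 := by
  let φ : EuclideanSpace ℝ (Fin n) →ₗ[ℝ] ℝ × ℝ :=
    (EuclideanSpace.proj i : EuclideanSpace ℝ (Fin n) →L[ℝ] ℝ).toLinearMap.prod
      (EuclideanSpace.proj j : EuclideanSpace ℝ (Fin n) →L[ℝ] ℝ).toLinearMap
  have h1 := φ.finrank_range_add_finrank_ker
  have h2 : Module.finrank ℝ φ.range ≤ 2 := by
    simpa using Submodule.finrank_le φ.range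
  rw [finrank_euclideanSpace_fin] at h1
  obtain ⟨U, hU, hUm⟩ := exists_submodule_le_finrank_eq φ.ker (m := m) (by omega)
  refine ⟨U, hUm, fun v hv => ?_⟩
  have := LinearMap.mem_ker.1 (hU hv)
  simpa [φ, Prod.ext_iff] using this

/-! ### The thickened cube with cyclic strips -/

/-- The union of the cube `Cⁿ` with the strips `{x i ∈ D, x (i + 1) ∈ C}`, where `i + 1` is taken
cyclically in `Fin n`. -/
def cyclicShell (n : ℕ) [NeZero n] (C D : Set ℝ) : Set (EuclideanSpace ℝ (Fin n)) :=
  {x | (∀ i, x i ∈ C) ∨ ∃ i, x i ∈ D ∧ x (i + 1) ∈ C}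

section Shell

variable [NeZero n] {C D C' D' : Set ℝ}

lemma cyclicShell_mono (hC : C ⊆ C') (hD : D ⊆ D') : cyclicShell n C D ⊆ cyclicShell n C' D' := by
  rintro x (h | ⟨i, h, h'⟩)
  · exact Or.inl fun i => hC (h i)
  · exact Or.inr ⟨i, hD h, hC h'⟩

lemma cyclicShell_eq : cyclicShell n C D = (⋂ i, {x | x i ∈ C}) ∪
    ⋃ i : Fin n, ({x | x i ∈ D} ∩ {x | x (i + 1) ∈ C}) := by
  ext x
  simp [cyclicShell]

lemma isClosed_cyclicShell (hC : IsClosed C) (hD : IsClosed D) :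
    IsClosed (cyclicShell n C D) := by
  have h (S : Set ℝ) (hS : IsClosed S) (i : Fin n) :
      IsClosed {x : EuclideanSpace ℝ (Fin n) | x i ∈ S} := hS.preimage (by fun_prop)
  rw [cyclicShell_eq]
  exact (isClosed_iInter fun i => h C hC i).union
    (isClosed_iUnion_of_finite fun i => (h D hD i).inter (h C hC _))

lemma isOpen_cyclicShell (hC : IsOpen C) (hD : IsOpen D) :
    IsOpen (cyclicShell n C D) := by
  have h (S : Set ℝ) (hS : IsOpen S) (i : Fin n) :
      IsOpen {x : EuclideanSpace ℝ (Fin n) | x i ∈ S} := hS.preimage (by fun_prop)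
  rw [cyclicShell_eq]
  exact (isOpen_iInter_of_finite fun i => h C hC i).union
    (isOpen_iUnion fun i => (h D hD i).inter (h C hC _))

lemma cyclicShell_interior_subset :
    cyclicShell n (interior C) (interior D) ⊆ interior (cyclicShell n C D) :=
  interior_maximal (cyclicShell_mono interior_subset interior_subset)
    (isOpen_cyclicShell isOpen_interior isOpen_interior)

lemma iUnion_cyclicShell {C D : ℕ → Set ℝ} (hC : Monotone C) (hD : Monotone D) :
    ⋃ k, cyclicShell n (C k) (D k) = cyclicShell n (⋃ k, C k) (⋃ k, D k) := by
  refine subset_antisymm (iUnion_subset fun k =>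
    cyclicShell_mono (subset_iUnion C k) (subset_iUnion D k)) ?_
  rintro x (h | ⟨i, h, h'⟩)
  · simp only [mem_iUnion] at h
    choose k hk using h
    exact mem_iUnion.2 ⟨Finset.univ.sup k, Or.inl fun i =>
      hC (Finset.le_sup (Finset.mem_univ i)) (hk i)⟩
  · obtain ⟨k, hk⟩ := mem_iUnion.1 h
    obtain ⟨l, hl⟩ := mem_iUnion.1 h'
    exact mem_iUnion.2 ⟨max k l, Or.inr ⟨i, hD (le_max_left k l) hk, hC (le_max_right k l) hl⟩⟩

/-! ### Connectedness of the complement -/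

open Fin.CommRing in
/-- A set of indices that is closed under the cyclic predecessor is empty or everything. -/
lemma forall_of_cyclic_pred {P : Fin n → Prop} (hP : ∀ i, P (i + 1) → P i) {k : Fin n} (hk : P k)
    (i : Fin n) : P i := by
  have h (t : ℕ) : P (k - (t : Fin n)) := by
    induction t with
    | zero => simpa using hk
    | succ t ih =>
      apply hP
      rwa [Nat.cast_succ, sub_add_eq_sub_sub, sub_add_cancel]
  have := h (k - i).val
  rwa [Fin.cast_val_eq_self, sub_sub_cancel] at this

/-- From a point outside the shell, some coordinate different from `p` can be moved to `p` without
meeting the shell. If some coordinate is in `C`, the right one is `x i ∈ C` with `x (i + 1) ∉ C`. -/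
lemma exists_update_notMem_cyclicShell (hn : 2 ≤ n) (hDC : D ⊆ C) {p : ℝ} (hp : p ∉ C)
    {x : EuclideanSpace ℝ (Fin n)} (hx : x ∉ cyclicShell n C D) (hxp : ∃ i, x i ≠ p) :
    ∃ i, x i ≠ p ∧ ∀ y : EuclideanSpace ℝ (Fin n), (∀ j, j ≠ i → y j = x j) →
      y ∉ cyclicShell n C D := by
  have hne (i : Fin n) : i + 1 ≠ i := by
    have : Nontrivial (Fin n) := Fin.nontrivial_iff_two_le.2 hn
    have : n ≠ 1 := by omega
    simpa using this
  simp only [cyclicShell, mem_ofPred_eq, not_or, not_forall, not_exists, not_and] at hx ⊢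
  obtain ⟨⟨k, hk⟩, hx⟩ := hx
  obtain ⟨i, hip, hi, hpred⟩ : ∃ i, x i ≠ p ∧ x (i + 1) ∉ C ∧ ∀ j, j + 1 = i → x j ∉ D := by
    by_cases h : ∀ i, x i ∉ C
    · obtain ⟨i, hi⟩ := hxp
      exact ⟨i, hi, h _, fun j _ hj => h j (hDC hj)⟩
    · have : ∃ i, x (i + 1) ∉ C ∧ x i ∈ C := by
        by_contra! hcon
        exact h (forall_of_cyclic_pred (P := fun i => x i ∉ C) hcon hk)
      obtain ⟨i, hi, hiC⟩ := this
      refine ⟨i, fun hc => hp (hc ▸ hiC), hi, ?_⟩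
      rintro j rfl hj
      exact hx j hj hiC
  refine ⟨i, hip, fun y hy => ⟨⟨i + 1, by rwa [hy _ (hne i)]⟩, fun j hj => ?_⟩⟩
  by_cases hji : j = i
  · subst hji
    rwa [hy _ (hne j)]
  · rw [hy j hji] at hj
    have hj1 : j + 1 ≠ i := fun h => hpred j h hj
    rw [hy _ hj1]
    exact hx j hj

lemma isConnected_compl_cyclicShell (hn : 2 ≤ n) (hDC : D ⊆ C) {p : ℝ} (hp : p ∉ C) :
    IsConnected (cyclicShell n C D)ᶜ := by
  -- Every point is joined to `q` by moving its coordinates to `p` one at a time.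
  let q : EuclideanSpace ℝ (Fin n) := WithLp.toLp 2 fun _ => p
  have hq : q ∉ cyclicShell n C D := by
    rintro (h | ⟨i, -, h⟩)
    · exact hp (h 0)
    · exact hp h
  refine IsPathConnected.isConnected ⟨q, hq, fun x hx => JoinedIn.symm ?_⟩
  induction hN : (Finset.univ.filter fun i => x i ≠ p).card using Nat.strong_induction_on
    generalizing x with
  | _ N ih =>
    by_cases hxp : ∃ i, x i ≠ p
    · obtain ⟨i, hip, hi⟩ := exists_update_notMem_cyclicShell hn hDC hp hx hxp
      let x' : EuclideanSpace ℝ (Fin n) := WithLp.toLp 2 (Function.update (fun j => x j) i p)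
      have hx'i : x' i = p := by simp [x']
      have hx'j (j : Fin n) (hj : j ≠ i) : x' j = x j := by simp [x', hj]
      have hseg : JoinedIn (cyclicShell n C D)ᶜ x x' := by
        apply JoinedIn.of_segment_subset
        rintro _ ⟨s, t, -, -, hst, rfl⟩
        refine hi _ fun j hj => ?_
        simp only [PiLp.add_apply, PiLp.smul_apply, smul_eq_mul, hx'j j hj]
        rw [← add_mul, hst, one_mul]
      refine hseg.trans (ih _ ?_ x' (hi x' hx'j) rfl)
      rw [← hN]
      apply Finset.card_lt_card
      refine (Finset.ssubset_iff_of_subset fun j hj => ?_).2 ⟨i, by simpa using hip, by simp [hx'i]⟩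
      have hj' : x' j ≠ p := by simpa using hj
      have hji : j ≠ i := fun h => hj' (h ▸ hx'i)
      simpa [hx'j j hji] using hj'
    · push Not at hxp
      have : x = q := by
        ext i
        exact hxp i
      rw [this]
      exact JoinedIn.refl hq

/-! ### Convexity properties of the complement -/

/-- A frontier point lies on a strip, and the plane through it on which the two coordinates defining
that strip are constant stays in the strip. -/
lemma isMConvexAt_compl_cyclicShell {m : ℕ} (hm : m + 2 ≤ n) (hC : IsClosed C) (hD : IsClosed D)
    (hCD : frontier C ⊆ D) {x : EuclideanSpace ℝ (Fin n)}
    (hx : x ∈ frontier (cyclicShell n C D)ᶜ) : IsMConvexAt m (cyclicShell n C D)ᶜ x := by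
  rw [frontier_compl, (isClosed_cyclicShell hC hD).frontier_eq] at hx
  obtain ⟨i, hi, hi'⟩ : ∃ i, x i ∈ D ∧ x (i + 1) ∈ C := by
    rcases hx.1 with h | h
    -- A frontier point of the cube has a coordinate at the frontier of `C`, which is in `D`.
    · by_contra! hcon
      refine hx.2 (cyclicShell_interior_subset (Or.inl fun i => ?_))
      by_contra hi
      exact hcon i (hCD (hC.frontier_eq ▸ ⟨h i, hi⟩)) (h _)
    · exact h
  obtain ⟨U, hU, hUi⟩ := exists_submodule_finrank_eq_of_two_coords hm i (i + 1)
  refine ⟨AffineSubspace.mk' x U, by rwa [AffineSubspace.direction_mk'],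
    AffineSubspace.self_mem_mk' x U, ?_⟩
  rw [← disjoint_iff_inter_eq_empty, disjoint_compl_right_iff_subset]
  intro y hy
  have h := hUi _ (AffineSubspace.mem_mk'.1 hy)
  simp only [vsub_eq_sub, PiLp.sub_apply, sub_eq_zero] at h
  exact Or.inr ⟨i, by rwa [h.1], by rwa [h.2]⟩

lemma isOpenWeaklyMConvex_compl_cyclicShell {m : ℕ} (hm : m + 2 ≤ n) (hC : IsClosed C)
    (hD : IsClosed D) (hCD : frontier C ⊆ D) :
    IsOpenWeaklyMConvex m (cyclicShell n C D)ᶜ :=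
  ⟨(isClosed_cyclicShell hC hD).isOpen_compl,
    fun _ hx => isMConvexAt_compl_cyclicShell hm hC hD hCD hx⟩

/-- Every plane of positive dimension through the origin leaves the shell: far out on a line through
the origin, each coordinate is zero or of absolute value greater than `R`. -/
lemma not_isMConvexAt_compl_cyclicShell {m : ℕ} (hm : 1 ≤ m) {R : ℝ} (hC : ∀ t ∈ C, |t| ≤ R)
    (hDC : D ⊆ C) (hD : (0 : ℝ) ∉ D) : ¬ IsMConvexAt m (cyclicShell n C D)ᶜ 0 := by
  rintro ⟨L, hL, h0, hLE⟩
  rw [← disjoint_iff_inter_eq_empty, disjoint_compl_right_iff_subset] at hLE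
  have hpos : 0 < Module.finrank ℝ L.direction := by omega
  obtain ⟨v, hv⟩ : ∃ v : L.direction, v ≠ 0 := Module.finrank_pos_iff_exists_ne_zero.1 hpos
  have hmem (t : ℝ) : t • (v : EuclideanSpace ℝ (Fin n)) ∈ L := by
    simpa using AffineSubspace.vadd_mem_of_mem_direction (L.direction.smul_mem t v.2) h0
  have hlarge : ∀ᶠ t : ℝ in atTop, ∀ i, v.1 i ≠ 0 → R < |t * v.1 i| := by
    refine eventually_all.2 fun i => ?_
    by_cases hi : v.1 i = 0
    · simp [hi]
    · have h : Tendsto (fun t : ℝ => |t| * |v.1 i|) atTop atTop :=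
        tendsto_abs_atTop_atTop.atTop_mul_const (abs_pos.2 hi)
      filter_upwards [h.eventually_gt_atTop R] with t ht _
      rwa [abs_mul]
  obtain ⟨t, ht⟩ := hlarge.exists
  obtain ⟨i, hi⟩ : ∃ i, v.1 i ≠ 0 := by
    by_contra! h
    exact hv (Subtype.ext (by ext i; exact h i))
  have hnot (i : Fin n) (hi : v.1 i ≠ 0) : t * v.1 i ∉ C := fun h => (hC _ h).not_gt (ht i hi)
  rcases hLE (hmem t) with h | ⟨j, hj, -⟩
  · exact hnot i hi (h i)
  · have hj : t * v.1 j ∈ D := hj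
    by_cases hvj : v.1 j = 0
    · rw [hvj, mul_zero] at hj
      exact hD hj
    · exact hnot j hvj (hDC hj)

lemma not_isMConvex_compl_cyclicShell {m : ℕ} (hm : 1 ≤ m) {R : ℝ} (hC : ∀ t ∈ C, |t| ≤ R)
    (hDC : D ⊆ C) (hD : (0 : ℝ) ∉ D) (h0 : (0 : ℝ) ∈ C) : ¬ IsMConvex m (cyclicShell n C D)ᶜ :=
  fun h => not_isMConvexAt_compl_cyclicShell hm hC hDC hD
    (h 0 (not_not.2 (Or.inl fun _ => h0)))

/-- An increasing sequence of closed shells, each in the interior of the next one, shows that the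
complement of the union is a closed weakly `m`-convex set. -/
lemma isClosedWeaklyMConvex_compl_cyclicShell_iUnion {m : ℕ} (hm : m + 2 ≤ n) {C D : ℕ → Set ℝ}
    (hC : ∀ k, IsClosed (C k)) (hD : ∀ k, IsClosed (D k)) (hCD : ∀ k, frontier (C k) ⊆ D k)
    (hC' : ∀ k, C k ⊆ interior (C (k + 1))) (hD' : ∀ k, D k ⊆ interior (D (k + 1))) :
    IsClosedWeaklyMConvex m (cyclicShell n (⋃ k, C k) (⋃ k, D k))ᶜ := by
  have hE : (cyclicShell n (⋃ k, C k) (⋃ k, D k))ᶜ = ⋂ k, (cyclicShell n (C k) (D k))ᶜ := by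
    rw [← iUnion_cyclicShell (monotone_nat_of_le_succ fun k => (hC' k).trans interior_subset)
      (monotone_nat_of_le_succ fun k => (hD' k).trans interior_subset), compl_iUnion]
  have hsub (k : ℕ) : closure (cyclicShell n (C (k + 1)) (D (k + 1)))ᶜ ⊆
      (cyclicShell n (C k) (D k))ᶜ := by
    rw [closure_compl, compl_subset_compl]
    exact (cyclicShell_mono (hC' k) (hD' k)).trans cyclicShell_interior_subset
  have hU (k : ℕ) := isOpenWeaklyMConvex_compl_cyclicShell hm (hC k) (hD k) (hCD k)
  refine ⟨?_, fun k => (cyclicShell n (C k) (D k))ᶜ, ⟨fun k => (hU k).1, hsub, hE⟩, hU⟩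
  have hE' : (cyclicShell n (⋃ k, C k) (⋃ k, D k))ᶜ =
      ⋂ k, closure (cyclicShell n (C k) (D k))ᶜ := by
    refine subset_antisymm (hE ▸ iInter_mono fun k => subset_closure) ?_
    rw [hE]
    exact subset_iInter fun k => (iInter_subset _ (k + 1)).trans (hsub k)
  rw [hE']
  exact isClosed_iInter fun k => isClosed_closure

end Shell

/-! ### The exhausting sequence of closed intervals and strips -/

/-- The number `1 / (k + 2)`, which is at most `1 / 2` and decreases to `0`. -/
noncomputable def gap (k : ℕ) : ℝ := 1 / (k + 2)

lemma gap_pos (k : ℕ) : 0 < gap k := by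
  unfold gap
  positivity

lemma gap_le_one_sub (k : ℕ) : gap k ≤ 1 - gap k := by
  have : gap k ≤ 1 / 2 := one_div_le_one_div_of_le two_pos (by simp)
  linarith

lemma gap_succ_lt (k : ℕ) : gap (k + 1) < gap k := by
  refine one_div_lt_one_div_of_lt (by positivity) ?_
  push_cast
  linarith

/-- The closed interval of radius `1 - gap k`; the radii increase to `1`. -/
def cubeSide (k : ℕ) : Set ℝ := {t | |t| ≤ 1 - gap k}

/-- The part of `cubeSide k` at distance at least `gap k` from `0`. It contains both endpoints of
`cubeSide k`, and increases to the open interval `(-1, 1)` without its centre. For `k = 0` it is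
`{1 / 2, -1 / 2}`. -/
def stripSide (k : ℕ) : Set ℝ := {t | gap k ≤ |t| ∧ |t| ≤ 1 - gap k}

lemma stripSide_subset_cubeSide (k : ℕ) : stripSide k ⊆ cubeSide k := fun _ h => h.2

lemma isClosed_cubeSide (k : ℕ) : IsClosed (cubeSide k) :=
  isClosed_le continuous_abs continuous_const

lemma isClosed_stripSide (k : ℕ) : IsClosed (stripSide k) :=
  (isClosed_le continuous_const continuous_abs).inter (isClosed_cubeSide k)

lemma frontier_cubeSide_subset (k : ℕ) : frontier (cubeSide k) ⊆ stripSide k := by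
  intro t ht
  have h : |t| = 1 - gap k := frontier_le_subset_eq continuous_abs continuous_const ht
  exact ⟨h ▸ gap_le_one_sub k, h.le⟩

lemma cubeSide_subset_interior (k : ℕ) : cubeSide k ⊆ interior (cubeSide (k + 1)) := by
  have hO : IsOpen {t : ℝ | |t| < 1 - gap (k + 1)} := isOpen_lt continuous_abs continuous_const
  refine Subset.trans (fun t (ht : |t| ≤ _) => ?_) (interior_maximal (fun t (ht : |t| < _) => ?_) hO)
  · exact ht.trans_lt (by linarith [gap_succ_lt k])
  · exact le_of_lt ht

lemma stripSide_subset_interior (k : ℕ) : stripSide k ⊆ interior (stripSide (k + 1)) := by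
  have hO : IsOpen ({t : ℝ | gap (k + 1) < |t|} ∩ {t : ℝ | |t| < 1 - gap (k + 1)}) :=
    (isOpen_lt continuous_const continuous_abs).inter (isOpen_lt continuous_abs continuous_const)
  refine Subset.trans (fun t ht => ?_) (interior_maximal (fun t ht => ?_) hO)
  · exact ⟨(gap_succ_lt k).trans_le ht.1, ht.2.trans_lt (by linarith [gap_succ_lt k])⟩
  · exact ⟨le_of_lt ht.1, le_of_lt ht.2⟩

lemma abs_le_one_of_mem_cubeSide (k : ℕ) {t : ℝ} (ht : t ∈ cubeSide k) : |t| ≤ 1 :=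
  le_trans ht (by linarith [gap_pos k])

lemma zero_mem_cubeSide (k : ℕ) : (0 : ℝ) ∈ cubeSide k := by
  show |(0 : ℝ)| ≤ _
  rw [abs_zero]
  exact (gap_pos k).le.trans (gap_le_one_sub k)

lemma zero_notMem_stripSide (k : ℕ) : (0 : ℝ) ∉ stripSide k := fun h => by
  have := h.1
  rw [abs_zero] at this
  exact this.not_gt (gap_pos k)

lemma two_notMem_cubeSide (k : ℕ) : (2 : ℝ) ∉ cubeSide k := fun h => by
  have := abs_le_one_of_mem_cubeSide k h
  norm_num at this

theorem mainTheorem4 (n m : ℕ) (hn : 3 ≤ n) (hm : 1 ≤ m) (hmn : m < n - 1) :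
    (∃ E : Set (EuclideanSpace ℝ (Fin n)),
      IsClosed E ∧ IsConnected E ∧ E ∈ WeaklyMConvexClass n m \ MConvexClass n m) ∧
    (∃ G : Set (EuclideanSpace ℝ (Fin n)),
      IsOpen G ∧ IsConnected G ∧ G ∈ WeaklyMConvexClass n m \ MConvexClass n m) := by
  have : NeZero n := ⟨by omega⟩
  have hn2 : 2 ≤ n := by omega
  have hmn2 : m + 2 ≤ n := by omega
  constructor
  · have hE := isClosedWeaklyMConvex_compl_cyclicShell_iUnion hmn2 isClosed_cubeSide
      isClosed_stripSide frontier_cubeSide_subset cubeSide_subset_interior stripSide_subset_interior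
    have hsub : ⋃ k, stripSide k ⊆ ⋃ k, cubeSide k := iUnion_mono stripSide_subset_cubeSide
    refine ⟨_, hE.1, isConnected_compl_cyclicShell hn2 hsub (p := 2) ?_, Or.inr hE,
      not_isMConvex_compl_cyclicShell hm (R := 1) ?_ hsub ?_ ?_⟩
    · simpa using two_notMem_cubeSide
    · intro t ht
      obtain ⟨k, hk⟩ := mem_iUnion.1 ht
      exact abs_le_one_of_mem_cubeSide k hk
    · simpa using zero_notMem_stripSide
    · exact mem_iUnion.2 ⟨0, zero_mem_cubeSide 0⟩
  · have hG := isOpenWeaklyMConvex_compl_cyclicShell hmn2 (isClosed_cubeSide 0)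
      (isClosed_stripSide 0) (frontier_cubeSide_subset 0)
    exact ⟨_, hG.1, isConnected_compl_cyclicShell hn2 (stripSide_subset_cubeSide 0)
      (two_notMem_cubeSide 0), Or.inl hG, not_isMConvex_compl_cyclicShell hm
      (fun _ => abs_le_one_of_mem_cubeSide 0) (stripSide_subset_cubeSide 0)
      (zero_notMem_stripSide 0) (zero_mem_cubeSide 0)⟩
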